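/- All groups are regarded as discrete. A group is amenable if it admits a left-invariant mean on its bounded real-valued functions. A group $G$ is residually amenable if for every $g\in G$ with $g\neq e$ there exist an amenable group $C$ and a surjective homomorphism $\varphi\colon G\twoheadrightarrow C$ such that $\varphi(g)\neq e$. The proamenable topology of $G$ is the group topology in which the normal subgroups $N\trianglelefteq G$ with $G/N$ amenable form a basis of neighbourhoods of the identity. Let $A$ be a group, let $H\leq A$ be a subgroup, and let $A\ast_H A$ be the double of $A$ along $H$, that is, the amalgamated free product of two copies of $A$ in which the two copies of $H$ are identified via the identity map $\mathrm{id}_H$. Then $A\ast_H A$ is residually amenable if and only if $A$ is residually amenable and $H$ is closed in the proamenable topology of $A$. -/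

import Mathlib

universe u v

/-- `m` is a left-invariant mean on the bounded real-valued functions on the (discrete) group `G`.
All conditions concern bounded functions only; the values of `m` at unbounded functions are
irrelevant. -/
structure IsLeftInvariantMean (G : Type u) [Group G] (m : (G → ℝ) → ℝ) : Prop where
  map_add : ∀ f₁ f₂ : G → ℝ, (∃ C : ℝ, ∀ x, |f₁ x| ≤ C) → (∃ C : ℝ, ∀ x, |f₂ x| ≤ C) →
    m (fun x => f₁ x + f₂ x) = m f₁ + m f₂
  map_smul : ∀ (c : ℝ) (f : G → ℝ), (∃ C : ℝ, ∀ x, |f x| ≤ C) →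
    m (fun x => c * f x) = c * m f
  map_nonneg : ∀ f : G → ℝ, (∃ C : ℝ, ∀ x, |f x| ≤ C) → (∀ x, 0 ≤ f x) → 0 ≤ m f
  map_one : m (fun _ => 1) = 1
  map_translate : ∀ (g : G) (f : G → ℝ), (∃ C : ℝ, ∀ x, |f x| ≤ C) →
    m (fun x => f (g * x)) = m f

/-- A discrete group is amenable if it admits a left-invariant mean on bounded functions. -/
def IsAmenableGroup (G : Type u) [Group G] : Prop :=
  ∃ m : (G → ℝ) → ℝ, IsLeftInvariantMean G m

/-- A group `G` is residually amenable if every non-trivial element has non-trivial image under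
some surjective homomorphism onto an amenable group. (A quotient of `G` can always be taken
in the universe of `G`.) -/
def IsResiduallyAmenable (G : Type u) [Group G] : Prop :=
  ∀ g : G, g ≠ 1 → ∃ (C : Type u) (_ : Group C) (φ : G →* C),
    IsAmenableGroup C ∧ Function.Surjective φ ∧ φ g ≠ 1

/-- The means of a bounded function are bounded by the same constant. -/
theorem IsLeftInvariantMean.abs_mean_le {G : Type u} [Group G] {m : (G → ℝ) → ℝ}
    (hm : IsLeftInvariantMean G m) {f : G → ℝ} {C : ℝ} (hf : ∀ x, |f x| ≤ C) : |m f| ≤ C := by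
  have hC : m (fun _ => C) = C := by
    have h := hm.map_smul C (fun _ => 1) ⟨1, by simp⟩
    rw [hm.map_one] at h
    simpa using h
  have hcb : ∃ K : ℝ, ∀ _ : G, |C| ≤ K := ⟨|C|, fun _ => le_rfl⟩
  have h1 := hm.map_add (fun _ => C) f hcb ⟨C, hf⟩
  have h2 := hm.map_add (fun _ => C) (fun x => (-1) * f x) hcb ⟨C, by simpa using hf⟩
  have h3 := hm.map_smul (-1) f ⟨C, hf⟩
  have hb : ∀ x, |C + f x| ≤ C + C := fun x => by
    have := abs_le.1 (hf x)
    rw [abs_le]; constructor <;> linarith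
  have hb' : ∀ x, |C + (-1) * f x| ≤ C + C := fun x => by
    have := abs_le.1 (hf x)
    rw [abs_le]; constructor <;> linarith
  have h4 := hm.map_nonneg (fun x => C + f x) ⟨_, hb⟩ fun x => by
    have := abs_le.1 (hf x); linarith
  have h5 := hm.map_nonneg (fun x => C + (-1) * f x) ⟨_, hb'⟩ fun x => by
    have := abs_le.1 (hf x); linarith
  rw [abs_le]; constructor <;> linarith

/-- The trivial group is amenable. -/
theorem isAmenableGroup_of_subsingleton (G : Type u) [Group G] [Subsingleton G] :
    IsAmenableGroup G :=
  ⟨fun f => f 1, fun _ _ _ _ => rfl, fun _ _ _ => rfl, fun _ _ h => h 1, rfl,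
    fun g f _ => congrArg f (Subsingleton.elim _ _)⟩

/-- The direct product of two amenable groups is amenable. -/
theorem IsAmenableGroup.prod {G : Type u} {K : Type v} [Group G] [Group K]
    (hG : IsAmenableGroup G) (hK : IsAmenableGroup K) : IsAmenableGroup (G × K) := by
  obtain ⟨m, hm⟩ := hG
  obtain ⟨n, hn⟩ := hK
  refine ⟨fun f => m fun x => n fun y => f (x, y), ?_, ?_, ?_, ?_, ?_⟩
  · rintro f₁ f₂ ⟨C₁, h₁⟩ ⟨C₂, h₂⟩
    rw [← hm.map_add _ _ ⟨C₁, fun x => hn.abs_mean_le fun y => h₁ (x, y)⟩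
      ⟨C₂, fun x => hn.abs_mean_le fun y => h₂ (x, y)⟩]
    congr 1; funext x
    exact hn.map_add _ _ ⟨C₁, fun y => h₁ (x, y)⟩ ⟨C₂, fun y => h₂ (x, y)⟩
  · rintro c f ⟨C, h⟩
    rw [← hm.map_smul c _ ⟨C, fun x => hn.abs_mean_le fun y => h (x, y)⟩]
    congr 1; funext x
    exact hn.map_smul c _ ⟨C, fun y => h (x, y)⟩
  · rintro f ⟨C, h⟩ h0
    exact hm.map_nonneg _ ⟨C, fun x => hn.abs_mean_le fun y => h (x, y)⟩ fun x =>
      hn.map_nonneg _ ⟨C, fun y => h (x, y)⟩ fun y => h0 (x, y)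
  · simp only [hn.map_one, hm.map_one]
  · rintro ⟨a, b⟩ f ⟨C, h⟩
    rw [← hm.map_translate a _ ⟨C, fun x => hn.abs_mean_le fun y => h (x, y)⟩]
    congr 1; funext x
    exact hn.map_translate b (fun y => f (a * x, y)) ⟨C, fun y => h (a * x, y)⟩

/-- A group that embeds into an amenable group is amenable. -/
theorem IsAmenableGroup.of_injective {G : Type u} {K : Type v} [Group G] [Group K]
    (hK : IsAmenableGroup K) (φ : G →* K) (hφ : Function.Injective φ) : IsAmenableGroup G := by
  obtain ⟨m, hm⟩ := hK
  -- a `G`-equivariant map `p : K → G`, built from representatives of the right cosets of `φ(G)`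
  obtain ⟨p, hp⟩ : ∃ p : K → G, ∀ g x, p (φ g * x) = g * p x := by
    let s : Setoid K := QuotientGroup.rightRel φ.range
    have hs : ∀ x : K, ∃ g : G, φ g * (Quotient.out (Quotient.mk s x)) = x := fun x => by
      have h : s (Quotient.out (Quotient.mk s x)) x := Quotient.exact (Quotient.out_eq _)
      rw [QuotientGroup.rightRel_apply] at h
      obtain ⟨g, hg⟩ := h
      exact ⟨g, by rw [hg]; group⟩
    choose p hp using hs
    refine ⟨p, fun g x => hφ ?_⟩
    have hq : Quotient.mk s (φ g * x) = Quotient.mk s x := by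
      apply Quotient.sound
      change s _ _
      rw [QuotientGroup.rightRel_apply]
      exact ⟨g⁻¹, by simp⟩
    have h1 := hp (φ g * x)
    rw [hq] at h1
    have h2 : φ g * (φ (p x) * (Quotient.out (Quotient.mk s x))) = φ g * x := by rw [hp x]
    rw [← h1, ← mul_assoc] at h2
    rw [_root_.map_mul]
    exact (mul_right_cancel h2).symm
  refine ⟨fun f => m fun x => f (p x), ?_, ?_, ?_, hm.map_one, ?_⟩
  · rintro f₁ f₂ ⟨C₁, h₁⟩ ⟨C₂, h₂⟩
    exact hm.map_add _ _ ⟨C₁, fun x => h₁ _⟩ ⟨C₂, fun x => h₂ _⟩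
  · rintro c f ⟨C, h⟩
    exact hm.map_smul c _ ⟨C, fun x => h _⟩
  · rintro f ⟨C, h⟩ h0
    exact hm.map_nonneg _ ⟨C, fun x => h _⟩ fun x => h0 _
  · rintro g f ⟨C, h⟩
    rw [← hm.map_translate (φ g) _ ⟨C, fun x => h (p x)⟩]
    simp only [hp]

/-- If `G ⧸ N` and `G ⧸ M` are amenable, then so is `G ⧸ (N ⊓ M)`. -/
theorem isAmenableGroup_quotient_inf {G : Type u} [Group G] (N M : Subgroup G) [N.Normal]
    [M.Normal] (hN : IsAmenableGroup (G ⧸ N)) (hM : IsAmenableGroup (G ⧸ M)) :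
    IsAmenableGroup (G ⧸ (N ⊓ M)) := by
  have hk : ((QuotientGroup.mk' N).prod (QuotientGroup.mk' M)).ker = N ⊓ M := by
    ext x
    simp [MonoidHom.mem_ker, Prod.ext_iff, Subgroup.mem_inf]
  refine (hN.prod hM).of_injective
    (QuotientGroup.lift (N ⊓ M) ((QuotientGroup.mk' N).prod (QuotientGroup.mk' M)) hk.ge) ?_
  rw [← MonoidHom.ker_eq_bot_iff, eq_bot_iff]
  intro x hx
  induction x using QuotientGroup.induction_on with
  | H z =>
    rw [MonoidHom.mem_ker, QuotientGroup.lift_mk, ← MonoidHom.mem_ker, hk] at hx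
    exact Subgroup.mem_bot.2 ((QuotientGroup.eq_one_iff z).2 hx)

/-- The basis at the identity of the proamenable topology of `G`: the normal subgroups `N` of `G`
with `G ⧸ N` amenable. -/
abbrev proamenableBasis (G : Type u) [Group G] : GroupFilterBasis G where
  sets := {U | ∃ (N : Subgroup G) (_ : N.Normal), IsAmenableGroup (G ⧸ N) ∧ U = (N : Set G)}
  nonempty := by
    have : Subsingleton (G ⧸ (⊤ : Subgroup G)) := QuotientGroup.subsingleton_quotient_top
    exact ⟨_, ⊤, inferInstance, isAmenableGroup_of_subsingleton _, rfl⟩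
  inter_sets := by
    rintro _ _ ⟨N, hN, hNa, rfl⟩ ⟨M, hM, hMa, rfl⟩
    exact ⟨_, ⟨N ⊓ M, inferInstance, isAmenableGroup_quotient_inf N M hNa hMa, rfl⟩, by simp⟩
  one' := by
    rintro _ ⟨N, hN, hNa, rfl⟩
    exact N.one_mem
  mul' := by
    rintro _ ⟨N, hN, hNa, rfl⟩
    refine ⟨_, ⟨N, hN, hNa, rfl⟩, ?_⟩
    rintro _ ⟨x, hx, y, hy, rfl⟩
    exact N.mul_mem hx hy
  inv' := by
    rintro _ ⟨N, hN, hNa, rfl⟩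
    exact ⟨_, ⟨N, hN, hNa, rfl⟩, fun x hx => N.inv_mem hx⟩
  conj' := by
    rintro g _ ⟨N, hN, hNa, rfl⟩
    exact ⟨_, ⟨N, hN, hNa, rfl⟩, fun x hx => hN.conj_mem x hx g⟩

/-- The proamenable topology of `G`. -/
abbrev proamenableTopology (G : Type u) [Group G] : TopologicalSpace G :=
  (proamenableBasis G).topology

/-- The double `A *_H A`: the amalgamated free product of two copies of `A` along the identity
of `H`, i.e. the pushout of the inclusion `H → A` with itself. -/
abbrev AmalgamDouble (A : Type u) [Group A] (H : Subgroup A) : Type u :=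
  Monoid.PushoutI (G := fun _ : Bool => A) (fun _ => H.subtype)

/-! If the double is residually amenable, so is its subgroup `A`. The two inclusions of `A` agree
only on `H`, so for `a ∉ H` some amenable quotient `C` of the double separates the two images of
`a`. The resulting map `A → C × C` sends `H`, but not `a`, into the diagonal, so `H` is closed.

Conversely, folding the double onto `A` detects the elements of the first copy. For any other
element, closedness gives an amenable quotient `B` of `A` in which the letters of a reduced word
stay outside the image `K` of `H`. Map the double to the wreath product of a finite symmetric group
with `B` (`toWreath`): the first copy goes to the top group, the second to its conjugate by a family
of involutions constant on the cosets of `K`, so that the copies agree on `H`. A coordinate of the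
image is a product of these involutions along a list of cosets with distinct neighbours
(`toWreath_prod_left`, `isChain_cosetPath`), and `exists_involutions_prod_ne_one` chooses them so
that it is non-trivial. The wreath product is amenable because a power of a finite group is locally
finite. -/

open Filter Topology

/-! ### Amenability of powers of finite groups and of wreath products -/

/-- A group that is the union of a family of finite subgroups, such that every element lies in all
sufficiently large members of the family, is amenable. -/
theorem isAmenableGroup_of_eventually_mem_finite {G : Type u} [Group G] {ι : Type v}
    (𝒰 : Ultrafilter ι) (S : ι → Subgroup G) [∀ i, Finite (S i)]
    (hS : ∀ g, ∀ᶠ i in (𝒰 : Filter ι), g ∈ S i) : IsAmenableGroup G := by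
  have (i : ι) : Fintype (S i) := Fintype.ofFinite _
  let avg (f : G → ℝ) (i : ι) : ℝ := (∑ p : S i, f p) / Fintype.card (S i)
  have hpos (i : ι) : (0 : ℝ) < Fintype.card (S i) := Nat.cast_pos.2 Fintype.card_pos
  have habs {f : G → ℝ} {C : ℝ} (hf : ∀ x, |f x| ≤ C) (i : ι) : |avg f i| ≤ C := by
    rw [abs_div, abs_of_pos (hpos i), div_le_iff₀ (hpos i)]
    refine (Finset.abs_sum_le_sum_abs _ _).trans ((Finset.sum_le_sum fun (p : S i) _ => hf p).trans ?_)
    simp [mul_comm]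
  have hlim {f : G → ℝ} (hf : ∃ C : ℝ, ∀ x, |f x| ≤ C) :
      Tendsto (avg f) 𝒰 (𝓝 (limUnder (𝒰 : Filter ι) (avg f))) := by
    obtain ⟨C, hC⟩ := hf
    apply tendsto_nhds_limUnder
    -- The averages stay in a compact interval, so they converge along the ultrafilter and
    -- `limUnder` is a genuine limit.
    obtain ⟨x, -, hx⟩ := (isCompact_Icc (a := -C) (b := C)).ultrafilter_le_nhds (𝒰.map (avg f))
      (le_principal_iff.2 (Filter.mem_map.2 (univ_mem' fun i => abs_le.1 (habs hC i))))
    exact ⟨x, hx⟩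
  refine ⟨fun f => limUnder (𝒰 : Filter ι) (avg f), ?_, ?_, ?_, ?_, ?_⟩
  · intro f₁ f₂ h₁ h₂
    refine (((hlim h₁).add (hlim h₂)).congr fun i => ?_).limUnder_eq
    simp only [avg, Finset.sum_add_distrib, add_div]
  · intro c f h
    refine (((hlim h).const_mul c).congr fun i => ?_).limUnder_eq
    simp only [avg, ← Finset.mul_sum, mul_div_assoc]
  · intro f h h0
    exact ge_of_tendsto' (hlim h) fun i =>
      div_nonneg (Finset.sum_nonneg fun p _ => h0 p) (hpos i).le
  · refine (tendsto_const_nhds.congr fun i => ?_).limUnder_eq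
    simp [avg]
  · intro g f h
    refine ((hlim h).congr' ?_).limUnder_eq
    filter_upwards [hS g] with i hi
    simp only [avg]
    -- Once `g` lies in `S i`, translation by `g` only permutes the terms of the average.
    rw [← Equiv.sum_comp (Equiv.mulLeft (⟨g, hi⟩ : S i))]
    rfl

/-- The subgroup of functions that are constant wherever all the members of `S` are. -/
def subgroupFactoringThrough {X : Type u} {U : Type v} [Group U] (S : Set (X → U)) :
    Subgroup (X → U) where
  carrier := {p | ∀ i j, (∀ s ∈ S, s i = s j) → p i = p j}
  mul_mem' ha hb i j h := by simp [ha i j h, hb i j h]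
  one_mem' _ _ _ := rfl
  inv_mem' ha i j h := by simp [ha i j h]

theorem subset_subgroupFactoringThrough {X : Type u} {U : Type v} [Group U] (S : Set (X → U)) :
    S ⊆ subgroupFactoringThrough S := fun s hs _ _ h => h s hs

/-- Each member factors through the joint evaluation `X → (S → U)`, whose target is finite.
Extending by `1` off the image is an arbitrary choice. -/
theorem finite_subgroupFactoringThrough {X : Type u} {U : Type v} [Group U] [Finite U]
    {S : Set (X → U)} (hS : S.Finite) : Finite (subgroupFactoringThrough S) := by
  have := hS.to_subtype
  let e (i : X) (s : S) : U := s.1 i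
  refine Finite.of_injective
    (fun p : subgroupFactoringThrough S => Function.extend e p.1 (1 : (S → U) → U)) ?_
  intro p q hpq
  have hfac (p : subgroupFactoringThrough S) : Function.FactorsThrough p.1 e :=
    fun i j h => p.2 i j fun s hs => congrFun h ⟨s, hs⟩
  ext i
  have h := congrFun hpq (e i)
  simpa [(hfac p).extend_apply, (hfac q).extend_apply] using h

/-- An arbitrary power of a finite group is amenable. -/
theorem isAmenableGroup_pi_of_finite (X : Type u) (U : Type v) [Group U] [Finite U] :
    IsAmenableGroup (X → U) := by
  classical
  have (S : Finset (X → U)) : Finite (subgroupFactoringThrough (S : Set (X → U))) :=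
    finite_subgroupFactoringThrough S.finite_toSet
  refine isAmenableGroup_of_eventually_mem_finite (Ultrafilter.of (atTop : Filter (Finset (X → U))))
    (fun S => subgroupFactoringThrough (S : Set (X → U))) fun g => ?_
  refine Ultrafilter.of_le _ ?_
  filter_upwards [eventually_ge_atTop {g}] with S hgS
  exact subset_subgroupFactoringThrough _ (by simpa using hgS)

/-- The unrestricted wreath product of amenable groups is amenable if its base is. -/
theorem IsAmenableGroup.regularWreathProduct {U : Type v} {B : Type u} [Group U] [Group B]
    (hU : IsAmenableGroup (B → U)) (hB : IsAmenableGroup B) :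
    IsAmenableGroup (RegularWreathProduct U B) := by
  obtain ⟨n, hn⟩ := hU
  obtain ⟨m, hm⟩ := hB
  -- The argument of `f` is `b` times the base element `p`. With `b` on the left, translation by
  -- `(q, a)` turns `b` into `a * b` and `p` into its product with a translate of `q`.
  refine ⟨fun f => m fun b => n fun p => f ⟨fun x => p (b⁻¹ * x), b⟩, ?_, ?_, ?_, ?_, ?_⟩
  · rintro f₁ f₂ ⟨C₁, h₁⟩ ⟨C₂, h₂⟩
    rw [← hm.map_add _ _ ⟨C₁, fun x => hn.abs_mean_le fun y => h₁ _⟩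
      ⟨C₂, fun x => hn.abs_mean_le fun y => h₂ _⟩]
    congr 1; funext x
    exact hn.map_add _ _ ⟨C₁, fun y => h₁ _⟩ ⟨C₂, fun y => h₂ _⟩
  · rintro c f ⟨C, h⟩
    rw [← hm.map_smul c _ ⟨C, fun x => hn.abs_mean_le fun y => h _⟩]
    congr 1; funext x
    exact hn.map_smul c _ ⟨C, fun y => h _⟩
  · rintro f ⟨C, h⟩ h0
    exact hm.map_nonneg _ ⟨C, fun x => hn.abs_mean_le fun y => h _⟩ fun x =>
      hn.map_nonneg _ ⟨C, fun y => h _⟩ fun y => h0 _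
  · simp only [hn.map_one, hm.map_one]
  · rintro ⟨q, a⟩ f ⟨C, h⟩
    refine Eq.trans ?_ (hm.map_translate a _ ⟨C, fun x => hn.abs_mean_le fun y => h _⟩)
    congr 1; funext b
    refine Eq.trans ?_ (hn.map_translate (fun x => q (a * b * x)) _ ⟨C, fun y => h _⟩)
    congr 1; funext p
    refine congrArg f ?_
    ext x <;> simp [mul_assoc]

/-! ### Separating paths by permutations of a finite set -/

section PathPerm

variable {X : Type*}

open Classical in
/-- For a list `L`, regarded as a path on the vertices `0, …, L.length` with edge `k` labelled by
the entry `k` of `L`, exchange the ends of every edge labelled `x`. -/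
noncomputable def pathSwap (L : List X) (x : X) (k : ℕ) : ℕ :=
  if L[k]? = some x then k + 1 else if 1 ≤ k ∧ L[k - 1]? = some x then k - 1 else k

theorem pathSwap_lt {L : List X} {x : X} {k : ℕ} (hk : k < L.length + 1) :
    pathSwap L x k < L.length + 1 := by
  unfold pathSwap
  split_ifs with h
  · have := (List.getElem?_eq_some_iff.1 h).1
    omega
  · omega
  · exact hk

/-- Consecutive edges have different labels, so the edges labelled `x` are pairwise disjoint. -/
theorem pathSwap_pathSwap {L : List X} (hL : L.IsChain (· ≠ ·)) (x : X) (k : ℕ) :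
    pathSwap L x (pathSwap L x k) = k := by
  have key (j : ℕ) (h₁ : L[j]? = some x) (h₂ : L[j + 1]? = some x) : False := by
    obtain ⟨hj, h₁⟩ := List.getElem?_eq_some_iff.1 h₁
    obtain ⟨hj', h₂⟩ := List.getElem?_eq_some_iff.1 h₂
    exact List.isChain_iff_getElem.1 hL j hj' (h₁.trans h₂.symm)
  by_cases h₁ : L[k]? = some x
  · have h₂ : L[k + 1]? ≠ some x := fun h => key k h₁ h
    simp [pathSwap, h₁, h₂]
  · by_cases h₂ : 1 ≤ k ∧ L[k - 1]? = some x
    · have h₃ : k - 1 + 1 = k := by omega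
      simp [pathSwap, h₁, h₂, h₃]
    · simp [pathSwap, h₁, h₂]

/-- The involution `pathSwap` as a permutation of the vertices. -/
noncomputable def pathPerm (L : List X) (hL : L.IsChain (· ≠ ·)) (x : X) :
    Equiv.Perm (Fin (L.length + 1)) :=
  Function.Involutive.toPerm (fun k => ⟨pathSwap L x k, pathSwap_lt k.2⟩) fun k =>
    Fin.ext (pathSwap_pathSwap hL x k)

theorem pathPerm_mul_self (L : List X) (hL : L.IsChain (· ≠ ·)) (x : X) :
    pathPerm L hL x * pathPerm L hL x = 1 := by
  ext k
  exact pathSwap_pathSwap hL x k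

/-- Permutations act from the right end of the word, and the letter at `k` moves vertex `k + 1` to
`k`. The whole word thus carries the last vertex to `0`. -/
theorem prod_pathPerm_drop_apply (L : List X) (hL : L.IsChain (· ≠ ·)) (k : ℕ)
    (hk : k ≤ L.length) : ((L.drop k).map (pathPerm L hL)).prod (Fin.last _) =
      ⟨k, Nat.lt_succ_of_le hk⟩ := by
  induction hk using Nat.decreasingInduction with
  | self => simp [Fin.last]
  | of_succ k hk ih =>
    rw [List.drop_eq_getElem_cons hk, List.map_cons, List.prod_cons, Equiv.Perm.mul_apply, ih]
    have h : L[k + 1]? ≠ some L[k] := fun h => by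
      obtain ⟨hk', h⟩ := List.getElem?_eq_some_iff.1 h
      exact List.isChain_iff_getElem.1 hL k hk' h.symm
    simp [pathPerm, pathSwap, h, hk]

/-- A non-empty word in a free product of groups of order two, without equal adjacent letters, is
non-trivial in some finite quotient. -/
theorem exists_involutions_prod_ne_one {L : List X} (hL : L.IsChain (· ≠ ·)) (hL' : L ≠ []) :
    ∃ (n : ℕ) (u : X → Equiv.Perm (Fin n)), (∀ x, u x * u x = 1) ∧ (L.map u).prod ≠ 1 := by
  refine ⟨_, pathPerm L hL, pathPerm_mul_self L hL, fun h => ?_⟩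
  have h₀ := prod_pathPerm_drop_apply L hL 0 (Nat.zero_le _)
  rw [List.drop_zero, h] at h₀
  have := congrArg Fin.val h₀
  simp only [Equiv.Perm.coe_one, id_eq, Fin.val_last] at this
  exact hL' (List.length_eq_zero_iff.1 this)

end PathPerm

open Monoid (PushoutI)

/-! ### Residual amenability and the proamenable topology -/

theorem IsResiduallyAmenable.of_injective {G K : Type u} [Group G] [Group K]
    (hK : IsResiduallyAmenable K) (φ : G →* K) (hφ : Function.Injective φ) :
    IsResiduallyAmenable G := by
  intro g hg
  obtain ⟨C, _, ψ, hC, -, hψg⟩ := hK (φ g) fun h => hg ((map_eq_one_iff φ hφ).1 h)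
  refine ⟨(ψ.comp φ).range, inferInstance, (ψ.comp φ).rangeRestrict,
    hC.of_injective (Subgroup.subtype _) (Subgroup.subtype_injective _),
    MonoidHom.rangeRestrict_surjective _, fun h => hψg ?_⟩
  simpa using congrArg Subtype.val h

theorem isAmenableGroup_quotient_ker {G : Type u} {K : Type v} [Group G] [Group K]
    (hK : IsAmenableGroup K) (φ : G →* K) : IsAmenableGroup (G ⧸ φ.ker) :=
  hK.of_injective (QuotientGroup.kerLift φ) (QuotientGroup.kerLift_injective φ)

/-- A subgroup is closed in the proamenable topology if and only if it can be separated from every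
element of the complement in an amenable quotient. -/
theorem isClosed_proamenableTopology_iff {A : Type u} [Group A] (H : Subgroup A) :
    @IsClosed A (proamenableTopology A) (H : Set A) ↔
      ∀ a ∉ H, ∃ (N : Subgroup A) (_ : N.Normal), IsAmenableGroup (A ⧸ N) ∧
        (a : A ⧸ N) ∉ H.map (QuotientGroup.mk' N) := by
  have hmem (N : Subgroup A) [N.Normal] (a : A) :
      (a : A ⧸ N) ∈ H.map (QuotientGroup.mk' N) ↔ ∃ n ∈ N, a * n ∈ H := by
    simp only [Subgroup.mem_map, QuotientGroup.mk'_apply]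
    constructor
    · rintro ⟨h, hh, e⟩
      exact ⟨a⁻¹ * h, QuotientGroup.eq.1 e.symm, by simpa using hh⟩
    · rintro ⟨n, hn, hh⟩
      exact ⟨_, hh, (QuotientGroup.eq.2 (by simpa using hn)).symm⟩
  let := proamenableTopology A
  rw [← isOpen_compl_iff, isOpen_iff_mem_nhds]
  refine forall₂_congr fun a _ => ?_
  rw [((proamenableBasis A).nhds_hasBasis a).mem_iff]
  constructor
  · rintro ⟨_, ⟨N, hN, hNa, rfl⟩, hsub⟩
    refine ⟨N, hN, hNa, fun h => ?_⟩
    obtain ⟨n, hn, hh⟩ := (hmem N a).1 h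
    exact hsub ⟨n, hn, rfl⟩ hh
  · rintro ⟨N, hN, hNa, h⟩
    refine ⟨N, ⟨N, hN, hNa, rfl⟩, ?_⟩
    rintro _ ⟨n, hn, rfl⟩ hh
    exact h ((hmem N a).2 ⟨n, hn, hh⟩)

/-- Finitely many elements can be separated simultaneously from a closed subgroup. -/
theorem exists_quotient_forall_notMem {A : Type u} [Group A] {H : Subgroup A}
    (hH : @IsClosed A (proamenableTopology A) (H : Set A)) (l : List A) (hl : ∀ a ∈ l, a ∉ H) :
    ∃ (N : Subgroup A) (_ : N.Normal), IsAmenableGroup (A ⧸ N) ∧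
      ∀ a ∈ l, (a : A ⧸ N) ∉ H.map (QuotientGroup.mk' N) := by
  induction l with
  | nil =>
    have : Subsingleton (A ⧸ (⊤ : Subgroup A)) := QuotientGroup.subsingleton_quotient_top
    exact ⟨⊤, inferInstance, isAmenableGroup_of_subsingleton _, by simp⟩
  | cons b l ih =>
    obtain ⟨N, hN, hNa, hNl⟩ := ih fun a ha => hl a (List.mem_cons_of_mem _ ha)
    obtain ⟨M, hM, hMa, hMb⟩ :=
      (isClosed_proamenableTopology_iff H).1 hH b (hl b List.mem_cons_self)
    have hle {N M : Subgroup A} [N.Normal] [M.Normal] (h : N ≤ M) (a : A)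
        (ha : (a : A ⧸ M) ∉ H.map (QuotientGroup.mk' M)) :
        (a : A ⧸ N) ∉ H.map (QuotientGroup.mk' N) := by
      rintro ⟨x, hx, e⟩
      exact ha ⟨x, hx, QuotientGroup.eq.2 (h (QuotientGroup.eq.1 e))⟩
    refine ⟨N ⊓ M, inferInstance, isAmenableGroup_quotient_inf N M hNa hMa, ?_⟩
    rintro a ha
    rcases List.mem_cons.1 ha with rfl | ha
    · exact hle inf_le_right _ hMb
    · exact hle inf_le_left _ (hNl a ha)

/-! ### The double -/

variable {A : Type u} [Group A] {H : Subgroup A}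

/-- The map from the double to `A` that identifies both copies. -/
def AmalgamDouble.fold (H : Subgroup A) : AmalgamDouble A H →* A :=
  PushoutI.lift (fun _ => MonoidHom.id A) H.subtype fun _ => rfl

theorem AmalgamDouble.fold_of (i : Bool) (a : A) :
    fold H (PushoutI.of (G := fun _ : Bool => A) (φ := fun _ => H.subtype) i a) = a := by
  simp [fold]

/-- The subgroup `H` is the equalizer of the two inclusions of `A` into the double. -/
theorem AmalgamDouble.mem_of_of_eq_of {a : A}
    (h : PushoutI.of (G := fun _ : Bool => A) (φ := fun _ => H.subtype) false a =
      PushoutI.of (G := fun _ : Bool => A) (φ := fun _ => H.subtype) true a) : a ∈ H := by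
  have hmem : PushoutI.of (G := fun _ : Bool => A) (φ := fun _ => H.subtype) false a ∈
      (PushoutI.base (G := fun _ : Bool => A) (fun _ => H.subtype)).range := by
    rw [← PushoutI.inf_of_range_eq_base_range (fun _ => H.subtype_injective)
      (i := false) (j := true) (by simp)]
    exact ⟨⟨a, rfl⟩, ⟨a, h.symm⟩⟩
  obtain ⟨x, hx⟩ := hmem
  -- The two factors meet in the amalgamated subgroup; folding identifies the element of `H` found
  -- there with `a`.
  have := congrArg (fold H) hx
  rw [← PushoutI.of_apply_eq_base (G := fun _ : Bool => A) (fun _ => H.subtype) false x,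
    fold_of, fold_of] at this
  exact this ▸ x.2

theorem isClosed_of_isResiduallyAmenable_double
    (hD : IsResiduallyAmenable (AmalgamDouble A H)) :
    @IsClosed A (proamenableTopology A) (H : Set A) := by
  rw [isClosed_proamenableTopology_iff]
  intro a ha
  let ι (i : Bool) : A →* AmalgamDouble A H :=
    PushoutI.of (G := fun _ : Bool => A) (φ := fun _ => H.subtype) i
  obtain ⟨C, _, φ, hC, -, hφ⟩ := hD (ι false a * (ι true a)⁻¹) fun h =>
    ha (AmalgamDouble.mem_of_of_eq_of (mul_inv_eq_one.1 h))
  -- The coordinates of `ψ` agree on `H` and differ at `a`.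
  let ψ := (φ.comp (ι false)).prod (φ.comp (ι true))
  refine ⟨ψ.ker, inferInstance, isAmenableGroup_quotient_ker (hC.prod hC) ψ, ?_⟩
  rintro ⟨x, hx, e⟩
  have e' : ψ x = ψ a := ψ.eq_iff.2 (QuotientGroup.eq.1 e.symm)
  have hι : ι false x = ι true x :=
    (PushoutI.of_apply_eq_base (G := fun _ : Bool => A) (fun _ => H.subtype) false ⟨x, hx⟩).trans
      (PushoutI.of_apply_eq_base (G := fun _ : Bool => A) (fun _ => H.subtype) true ⟨x, hx⟩).symm
  apply hφ
  rw [_root_.map_mul, _root_.map_inv, mul_inv_eq_one]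
  have h₁ : φ (ι false x) = φ (ι false a) := congrArg Prod.fst e'
  have h₂ : φ (ι true x) = φ (ι true a) := congrArg Prod.snd e'
  rw [← h₁, ← h₂, hι]

/-! ### Wreath product quotients of the double and reduced words -/

namespace AmalgamDouble

variable {B : Type u} [Group B] {U : Type v} [Group U]

/-- Given `f : A → B` and a family of involutions of `U` that is indexed by `B` and constant on left
cosets of `f(H)`, embed the first copy of `A` in the double as `f` into the top group of the wreath
product, and the second copy as its conjugate by the family of involutions. -/
def toWreath (f : A →* B) (η : B → U) (hη : ∀ b, η b * η b = 1)
    (hηH : ∀ b, ∀ h ∈ H, η (b * f h) = η b) : AmalgamDouble A H →* RegularWreathProduct U B :=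
  PushoutI.lift
    (fun i => bif i then
      -- This is the conjugate of `inl (f a)` by the base element `x ↦ η x⁻¹`, whose values are
      -- their own inverses. For `a ∈ H` the two factors cancel.
      { toFun := fun a => ⟨fun x => η x⁻¹ * η (x⁻¹ * f a), f a⟩
        map_one' := by ext x <;> simp [hη]
        map_mul' := fun a b => by
          ext x
          · have := hη (x⁻¹ * f a)
            simp only [_root_.map_mul, RegularWreathProduct.mul_left, Pi.mul_apply, mul_inv_rev,
              inv_inv]
            rw [mul_assoc (η x⁻¹), ← mul_assoc (η (x⁻¹ * f a)), this, one_mul, mul_assoc]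
          · simp }
      else RegularWreathProduct.inl.comp f)
    (RegularWreathProduct.inl.comp (f.comp H.subtype)) fun i => by
      cases i
      · rfl
      · ext a x <;> simp [hη, hηH]

theorem toWreath_of_false (f : A →* B) (η : B → U) (hη) (hηH) (a : A) :
    toWreath (H := H) f η hη hηH
      (PushoutI.of (G := fun _ : Bool => A) (φ := fun _ => H.subtype) false a) =
      RegularWreathProduct.inl (f a) := by
  simp [toWreath]

/-- The cosets that occur when the word `l`, after the start `c`, is mapped to a wreath product. -/
def cosetPath (f : A →* B) (K : Subgroup B) : B → List (Σ _ : Bool, A) → List (B ⧸ K)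
  | _, [] => []
  | c, ⟨false, a⟩ :: l => cosetPath f K (c * f a) l
  | c, ⟨true, a⟩ :: l => (c : B ⧸ K) :: ((c * f a : B) : B ⧸ K) :: cosetPath f K (c * f a) l

/-- Splitting off a letter `a` moves the coordinate from `c⁻¹` to `(c * f a)⁻¹`. A letter of the
first copy contributes nothing else; one of the second contributes the involutions at `c` and `c * f
a`. -/
theorem toWreath_prod_left (f : A →* B) (K : Subgroup B) (u : B ⧸ K → U) (hu) (hη)
    (l : List (Σ _ : Bool, A)) (c : B) :
    (toWreath (H := H) f (fun b => u b) hu hη (l.map fun x =>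
      PushoutI.of (G := fun _ : Bool => A) (φ := fun _ => H.subtype) x.1 x.2).prod).left c⁻¹ =
      ((cosetPath f K c l).map u).prod := by
  induction l generalizing c with
  | nil => simp [cosetPath]
  | cons x l ih =>
    obtain ⟨i, a⟩ := x
    have ih := ih (c * f a)
    rw [mul_inv_rev] at ih
    rw [List.map_cons, List.prod_cons, _root_.map_mul, RegularWreathProduct.mul_left, Pi.mul_apply]
    cases i
    · simpa [toWreath, cosetPath] using ih
    · simp [toWreath, cosetPath, mul_assoc] at ih ⊢
      exact ih

/-- Every letter changes the coset, being outside `K`. Between two letters of the second copy there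
is one of the first, which separates the end of one pair of cosets from the start of the next. The
second conjunct carries this through the induction. -/
theorem isChain_cosetPath (f : A →* B) (K : Subgroup B) (l : List (Σ _ : Bool, A))
    (hl : l.IsChain fun x y => x.1 ≠ y.1) (hK : ∀ x ∈ l, f x.2 ∉ K) (c : B) :
    (cosetPath f K c l).IsChain (· ≠ ·) ∧
      ((∀ x ∈ l.head?, x.1 = false) →
        ((c : B ⧸ K) :: cosetPath f K c l).IsChain (· ≠ ·)) := by
  induction l generalizing c with
  | nil => simp [cosetPath]
  | cons x l ih =>
    obtain ⟨i, a⟩ := x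
    obtain ⟨hx, hl⟩ := List.isChain_cons.1 hl
    have ih := ih hl (fun x hx => hK x (List.mem_cons_of_mem _ hx)) (c * f a)
    have hne : (c : B ⧸ K) ≠ ((c * f a : B) : B ⧸ K) := fun h =>
      hK _ List.mem_cons_self (by simpa using QuotientGroup.eq.1 h)
    cases i
    · refine ⟨ih.1, fun _ => ?_⟩
      cases l with
      | nil => simp [cosetPath]
      | cons y l =>
        obtain ⟨j, b⟩ := y
        have hj : j = true := by simpa using hx
        subst hj
        exact List.IsChain.cons_cons hne ih.1
    · refine ⟨List.IsChain.cons_cons hne (ih.2 fun x hxl => ?_), fun h => ?_⟩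
      · simpa using (hx x hxl).symm
      · simp at h

theorem prod_mem_range_of_cosetPath_eq_nil (f : A →* B) (K : Subgroup B)
    (l : List (Σ _ : Bool, A)) (c : B) (h : cosetPath f K c l = []) :
    (l.map fun x => PushoutI.of (G := fun _ : Bool => A) (φ := fun _ => H.subtype) x.1 x.2).prod ∈
      (PushoutI.of (G := fun _ : Bool => A) (φ := fun _ => H.subtype) false).range := by
  induction l generalizing c with
  | nil => simp
  | cons x l ih =>
    obtain ⟨i, a⟩ := x
    cases i
    · rw [List.map_cons, List.prod_cons]
      exact mul_mem ⟨a, rfl⟩ (ih (c * f a) h)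
    · simp [cosetPath] at h

/-- Every element of the double is the product of an element of `H` and an alternating word of
elements outside `H`. -/
theorem exists_reduced_word (g : AmalgamDouble A H) :
    ∃ (h : A) (l : List (Σ _ : Bool, A)), h ∈ H ∧ (l.IsChain fun x y => x.1 ≠ y.1) ∧
      (∀ x ∈ l, x.2 ∉ H) ∧
      g = PushoutI.of (G := fun _ : Bool => A) (φ := fun _ => H.subtype) false h *
        (l.map fun x =>
          PushoutI.of (G := fun _ : Bool => A) (φ := fun _ => H.subtype) x.1 x.2).prod := by
  classical
  obtain ⟨d⟩ := PushoutI.NormalWord.transversal_nonempty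
    (G := fun _ : Bool => A) (fun _ => H.subtype) fun _ => H.subtype_injective
  obtain ⟨w, rfl⟩ := (PushoutI.NormalWord.equiv (d := d)).symm.surjective g
  refine ⟨w.head, w.toList, w.head.2, w.chain_ne, fun x hx hxH => ?_, ?_⟩
  · refine w.ne_one x hx ?_
    -- A letter in `H` factors both as itself times `1` and as `1` times itself, so uniqueness of
    -- the transversal decomposition makes it trivial.
    have h1 := (d.compl x.1).1 (a₁ := (⟨x.2, by simpa using hxH⟩, ⟨1, d.one_mem _⟩))
      (a₂ := (1, ⟨x.2, w.normalized _ _ hx⟩)) (by simp)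
    simpa using (congrArg (fun p => (p.2 : A)) h1).symm
  · change PushoutI.NormalWord.prod w = _
    rw [PushoutI.NormalWord.prod,
      ← PushoutI.of_apply_eq_base (G := fun _ : Bool => A) (fun _ => H.subtype) false,
      Monoid.CoprodI.Word.prod, map_list_prod, List.map_map]
    congr 3

end AmalgamDouble

theorem isResiduallyAmenable_double (hA : IsResiduallyAmenable A)
    (hH : @IsClosed A (proamenableTopology A) (H : Set A)) :
    IsResiduallyAmenable (AmalgamDouble A H) := by
  intro g hg
  by_cases hr : g ∈ (PushoutI.of (G := fun _ : Bool => A) (φ := fun _ => H.subtype) false).range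
  · obtain ⟨a, rfl⟩ := hr
    obtain ⟨C, _, φ, hC, hφ, hφa⟩ := hA a fun h => hg (by rw [h, _root_.map_one])
    refine ⟨C, inferInstance, φ.comp (AmalgamDouble.fold H), hC, hφ.comp fun a =>
      ⟨_, AmalgamDouble.fold_of false a⟩, ?_⟩
    rwa [MonoidHom.comp_apply, AmalgamDouble.fold_of]
  obtain ⟨h, l, hh, hl, hlH, rfl⟩ := AmalgamDouble.exists_reduced_word g
  obtain ⟨N, hN, hNa, hNl⟩ := exists_quotient_forall_notMem hH (l.map Sigma.snd)
    (List.forall_mem_map.2 hlH)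
  let f := QuotientGroup.mk' N
  let K := H.map f
  -- An empty path means that no letter comes from the second copy.
  have hne : AmalgamDouble.cosetPath f K (f h) l ≠ [] := fun h0 =>
    hr (mul_mem ⟨h, rfl⟩ (AmalgamDouble.prod_mem_range_of_cosetPath_eq_nil f K l _ h0))
  obtain ⟨n, u, hu, hprod⟩ := exists_involutions_prod_ne_one
    (AmalgamDouble.isChain_cosetPath f K l hl
      (fun x hx => hNl x.2 (List.mem_map_of_mem hx)) (f h)).1 hne
  have huK (b : A ⧸ N) (x : A) (hx : x ∈ H) :
      u ((b * f x : A ⧸ N) : (A ⧸ N) ⧸ K) = u (b : (A ⧸ N) ⧸ K) :=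
    congrArg u (QuotientGroup.mk_mul_of_mem b (Subgroup.mem_map_of_mem f hx))
  let ψ := AmalgamDouble.toWreath (H := H) f (fun b => u (b : (A ⧸ N) ⧸ K)) (fun b => hu b) huK
  have hamen : IsAmenableGroup (RegularWreathProduct (Equiv.Perm (Fin n)) (A ⧸ N)) :=
    (isAmenableGroup_pi_of_finite _ _).regularWreathProduct hNa
  refine ⟨ψ.range, inferInstance, ψ.rangeRestrict,
    hamen.of_injective (Subgroup.subtype _) (Subgroup.subtype_injective _),
    ψ.rangeRestrict_surjective, fun h1 => hprod ?_⟩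
  -- The prefix `inl (f h)` shifts the coordinate `1` to `(f h)⁻¹`, which is why the path starts at
  -- `f h`.
  have h2 := congrArg (fun z => z.left 1) (congrArg Subtype.val h1)
  rw [MonoidHom.coe_rangeRestrict, _root_.map_mul, AmalgamDouble.toWreath_of_false] at h2
  rw [← AmalgamDouble.toWreath_prod_left (H := H) f K u (fun b => hu b) huK]
  simpa using h2

theorem corollary10 (A : Type u) [Group A] (H : Subgroup A) :
    IsResiduallyAmenable (AmalgamDouble A H) ↔
      IsResiduallyAmenable A ∧ @IsClosed A (proamenableTopology A) (H : Set A) := by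
  refine ⟨fun hD => ⟨hD.of_injective
    (PushoutI.of (G := fun _ : Bool => A) (φ := fun _ => H.subtype) false)
    (PushoutI.of_injective (fun _ => H.subtype_injective) false),
    isClosed_of_isResiduallyAmenable_double hD⟩, fun h => isResiduallyAmenable_double h.1 h.2⟩
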